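/- Regard a poset as a category with a unique arrow $I\to J$ iff $I\le J$. For a category $\mathsf I$, let $\pi_1(\mathsf I)$ be the groupoid freely generated by the category $\mathsf I$; $\mathsf I$ is *simply-connected* if $\pi_1(\mathsf I)$ has at most one morphism between any two objects. An *inverse category* is a category in which every morphism $f:X\to Y$ has a unique pseudoinverse, i.e. a unique $f^{-1}:Y\to X$ with $f\circ f^{-1}\circ f=f$ and $f^{-1}\circ f\circ f^{-1}=f^{-1}$. Let $\mathcal L(\mathsf I)$ be the inverse category freely generated by $\mathsf I$ subject to every morphism $i:I\to J$ of $\mathsf I$ becoming monic, i.e. $i^{-1}\circ i=1_I$ in $\mathcal L(\mathsf I)$; $\mathsf I$ is *upward-simply-connected* if every endomorphism $f$ in $\mathcal L(\mathsf I)$ is idempotent, $f\circ f=f$. A poset is *connected* if it is nonempty and any two of its elements are joined by a zigzag of comparable elements. The class of *finite tree-like* posets is defined inductively (up to isomorphism) by one rule: if $n\ge 0$, $\mathsf K_1,\dots,\mathsf K_n$ are finite tree-like posets and $\mathsf U_k\subseteq\mathsf K_k$ is a connected upward-closed subset for each $k$, then the poset obtained from the disjoint union of the $\mathsf K_k$ (elements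 of different $\mathsf K_k$ being incomparable) by adjoining a single new point lying below exactly itself and the elements of the $\mathsf U_k$, and above no other element, is tree-like. A finite poset is *forest-like* if it is isomorphic to a disjoint union of finitely many (possibly zero) finite tree-like posets. **Corollary.** For a finite poset $\mathsf I$, the following are equivalent: 1. $\mathsf I$ is upward-simply-connected; 2. every upward-closed subset $\mathsf J\subseteq\mathsf I$ (with the induced order) is simply-connected; 3. $\mathsf I$ is forest-like. -/

import Mathlib

open CategoryTheory

universe v u

/-! ## Simply-connected categories -/

/-- A category is simply-connected if its fundamental groupoid (the groupoid freely generated by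
the category) has at most one morphism between any two objects. -/
def IsSimplyConnectedCat (C : Type u) [Category.{v} C] : Prop :=
  ∀ X Y : FreeGroupoid C, Subsingleton (X ⟶ Y)

/-! ## The left fundamental inverse category -/

/-- Formal expressions in the arrows of `C`, built by composition (written in diagrammatic order)
and formal pseudoinverse. -/
inductive InvTerm (C : Type u) [Category.{v} C] : C → C → Type (max u v)
  | of {X Y : C} (f : X ⟶ Y) : InvTerm C X Y
  | comp {X Y Z : C} (s : InvTerm C X Y) (t : InvTerm C Y Z) : InvTerm C X Z
  | inv {X Y : C} (t : InvTerm C X Y) : InvTerm C Y X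

namespace InvTerm

variable {C : Type u} [Category.{v} C]

/-- The congruence on formal expressions generated by
* the category axioms and the relations of `C` (`assoc`, `id_comp`, `comp_id`, `of_comp`);
* the equational axioms of inverse categories: `(t⁻¹)⁻¹ = t`, `t ∘ t⁻¹ ∘ t = t`, and the
  idempotents `s⁻¹ ∘ s` and `t⁻¹ ∘ t` commute (`inv_inv`, `regular`, `comm`);
* the relation `f⁻¹ ∘ f = 1` for each arrow `f` of `C`, which says that `f` becomes monic. -/
inductive Rel : ∀ {X Y : C}, InvTerm C X Y → InvTerm C X Y → Prop
  | refl {X Y : C} (t : InvTerm C X Y) : Rel t t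
  | symm {X Y : C} {s t : InvTerm C X Y} : Rel s t → Rel t s
  | trans {X Y : C} {s t r : InvTerm C X Y} : Rel s t → Rel t r → Rel s r
  | comp_congr {X Y Z : C} {s s' : InvTerm C X Y} {t t' : InvTerm C Y Z} :
      Rel s s' → Rel t t' → Rel (s.comp t) (s'.comp t')
  | inv_congr {X Y : C} {t t' : InvTerm C X Y} : Rel t t' → Rel t.inv t'.inv
  | assoc {W X Y Z : C} (r : InvTerm C W X) (s : InvTerm C X Y) (t : InvTerm C Y Z) :
      Rel ((r.comp s).comp t) (r.comp (s.comp t))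
  | id_comp {X Y : C} (t : InvTerm C X Y) : Rel ((of (𝟙 X)).comp t) t
  | comp_id {X Y : C} (t : InvTerm C X Y) : Rel (t.comp (of (𝟙 Y))) t
  | of_comp {X Y Z : C} (f : X ⟶ Y) (g : Y ⟶ Z) : Rel (of (f ≫ g)) ((of f).comp (of g))
  | inv_inv {X Y : C} (t : InvTerm C X Y) : Rel t.inv.inv t
  | regular {X Y : C} (t : InvTerm C X Y) : Rel ((t.comp t.inv).comp t) t
  | comm {X Y Z : C} (s : InvTerm C X Y) (t : InvTerm C X Z) :
      Rel ((s.comp s.inv).comp (t.comp t.inv)) ((t.comp t.inv).comp (s.comp s.inv))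
  | monic {X Y : C} (f : X ⟶ Y) : Rel ((of f).comp (of f).inv) (of (𝟙 X))

/-- The congruence `InvTerm.Rel` as a setoid. -/
def setoid (X Y : C) : Setoid (InvTerm C X Y) :=
  ⟨Rel, Rel.refl, Rel.symm, Rel.trans⟩

end InvTerm

/-- The left fundamental inverse category of `C`: the inverse category freely generated by `C`
subject to every arrow of `C` becoming monic. It has the same objects as `C`, and its morphisms
are formal expressions modulo `InvTerm.Rel`. -/
structure LeftFundamental (C : Type u) where
  /-- The underlying object of `C`. -/
  as : C

instance (C : Type u) [Category.{v} C] : Category.{max u v} (LeftFundamental C) where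
  Hom X Y := _root_.Quotient (InvTerm.setoid X.as Y.as)
  id X := _root_.Quotient.mk _ (InvTerm.of (𝟙 X.as))
  comp f g := _root_.Quotient.map₂ InvTerm.comp
    (fun _ _ h _ _ h' => InvTerm.Rel.comp_congr h h') f g
  id_comp f := _root_.Quotient.inductionOn f fun t => _root_.Quotient.sound (InvTerm.Rel.id_comp t)
  comp_id f := _root_.Quotient.inductionOn f fun t => _root_.Quotient.sound (InvTerm.Rel.comp_id t)
  assoc f g h := _root_.Quotient.inductionOn₃ f g h fun r s t => _root_.Quotient.sound (InvTerm.Rel.assoc r s t)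

/-- A category is idempotent if all of its endomorphisms are idempotent. -/
def IsIdempotentCat (C : Type u) [Category.{v} C] : Prop :=
  ∀ (X : C) (f : X ⟶ X), f ≫ f = f

/-- A category is upward-simply-connected if its left fundamental inverse category is
idempotent. -/
def IsUpwardSimplyConnected (C : Type u) [Category.{v} C] : Prop :=
  IsIdempotentCat (LeftFundamental C)

/-! ## Tree-like and forest-like posets -/

/-- The set `P` together with one new point. -/
inductive AdjoinBelow (P : Type u) [PartialOrder P] (U : UpperSet P) : Type u
  | pt : AdjoinBelow P U
  | of (x : P) : AdjoinBelow P U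

namespace AdjoinBelow

variable {P : Type u} [PartialOrder P] {U : UpperSet P}

/-- The new point lies below itself and the elements of `U`, and below nothing else; no element
of `P` lies below the new point; the order among the elements of `P` is unchanged. -/
protected def le : AdjoinBelow P U → AdjoinBelow P U → Prop
  | pt, pt => True
  | pt, of x => x ∈ U
  | of _, pt => False
  | of x, of y => x ≤ y

instance : PartialOrder (AdjoinBelow P U) where
  le := AdjoinBelow.le
  le_refl a := by
    cases a with
    | pt => exact trivial
    | of x => exact le_refl x
  le_trans a b c hab hbc := by
    cases a with
    | pt =>
      cases c with
      | pt => exact trivial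
      | of z =>
        cases b with
        | pt => exact hbc
        | of y => exact U.upper hbc hab
    | of x =>
      cases b with
      | pt => exact hab.elim
      | of y =>
        cases c with
        | pt => exact hbc.elim
        | of z => exact le_trans (a := x) hab hbc
  le_antisymm a b hab hba := by
    cases a with
    | pt =>
      cases b with
      | pt => rfl
      | of y => exact hba.elim
    | of x =>
      cases b with
      | pt => exact hab.elim
      | of y => exact congrArg of (le_antisymm (a := x) hab hba)

end AdjoinBelow

/-- The union of upper sets `U k` of posets `K k`, as an upper set of the disjoint union (where
elements of different summands are incomparable). -/
def sigmaUpperSet {n : ℕ} {K : Fin n → Type u} [∀ k, PartialOrder (K k)]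
    (U : ∀ k, UpperSet (K k)) : UpperSet (Σ k, K k) where
  carrier := {x | x.2 ∈ U x.1}
  upper' := by
    rintro _ _ ⟨k, x, y, hxy⟩ hx
    exact (U k).upper hxy hx

/-- Finite tree-like posets, up to isomorphism: given tree-like posets `K k`, finite in number, and
a connected upward-closed subset `U k` of each, adjoin to the disjoint union of the `K k` a single
point lying below each `U k`. Connected includes nonempty; taking no `K k` at all gives the
one-point poset. -/
inductive IsTreeLike : (P : Type u) → [PartialOrder P] → Prop
  | adjoin {n : ℕ} (K : Fin n → Type u) [∀ k, PartialOrder (K k)] (U : ∀ k, UpperSet (K k))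
      (tree : ∀ k, IsTreeLike (K k)) (conn : ∀ k, CategoryTheory.IsConnected ↥(U k))
      (P : Type u) [PartialOrder P] (e : P ≃o AdjoinBelow (Σ k, K k) (sigmaUpperSet U)) :
      IsTreeLike P

/-- A poset is (finite) forest-like if it is a finite disjoint union of tree-like posets. -/
def IsForestLike (P : Type u) [PartialOrder P] : Prop :=
  ∃ (n : ℕ) (K : Fin n → Type u) (_ : ∀ k, PartialOrder (K k)),
    (∀ k, IsTreeLike (K k)) ∧ Nonempty (P ≃o Σ k, K k)

/-! ## Monodromy

Consider functors `Φ` from a category to types and injective functions, and ask whether transport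
of elements along zigzags is path-independent. Formal expressions in the arrows act on `Φ` by
partial bijections, so transport is path-independent if the category is upward-simply-connected.
For the converse, and to see that upper sets are then simply-connected, take `Φ` to consist of the
morphisms out of an object of the left fundamental inverse category, or of the fundamental groupoid
of an upper set.

Path-independence is inherited by disjoint unions, and by a poset to which a point is adjoined
below an upper set that meets each connected component in a connected set. Conversely, let `p` be a
minimal element of a connected, simply-connected upper set `A`. A locally constant function on the
elements above `p` extends to `A \ {p}`, so the elements above `p` in each connected component of
`A \ {p}` form a connected set, and `A` is tree-like by induction. -/

universe w

theorem apply_eq_of_zigzag {C : Type*} [Category* C] {α : Type*} {f : C → α}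
    (hf : ∀ ⦃x y : C⦄, (x ⟶ y) → f x = f y) {x y : C} (h : Zigzag x y) : f x = f y := by
  induction h with
  | refl => rfl
  | tail _ h ih =>
    rcases h with ⟨⟨g⟩⟩ | ⟨⟨g⟩⟩
    · exact ih.trans (hf g)
    · exact ih.trans (hf g).symm

/-- A category has trivial monodromy if, for every functor from it to types and injective
functions, parallel transport along zigzags does not depend on the zigzag: a connected component
of the category of elements contains at most one element over each object. -/
def HasTrivialMonodromy (C : Type u) [Category.{v} C] : Prop :=
  ∀ Φ : C ⥤ Type w, (∀ ⦃x y : C⦄ (f : x ⟶ y), Function.Injective (Φ.map f)) →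
    ∀ (x : C) (a b : Φ.obj x), Zigzag (Φ.elementsMk x a) (Φ.elementsMk x b) → a = b

section PartialBijections

variable {α β γ : Type*}

/-- An injective function, as a partial bijection. -/
noncomputable def pequivOfInjective (f : α → β) (hf : Function.Injective f) : α ≃. β where
  toFun a := some (f a)
  invFun := Function.partialInv f
  inv a b := by rw [hf.isPartialInv a b, Option.some_inj]

@[simp]
theorem pequivOfInjective_apply (f : α → β) (hf : Function.Injective f) (a : α) :
    pequivOfInjective f hf a = some (f a) := rfl

theorem pequiv_trans_symm_eq_some_iff {f : α ≃. β} {a a' : α} :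
    (f.trans f.symm) a = some a' ↔ a = a' ∧ (f a).isSome := by
  classical
  rw [PEquiv.self_trans_symm, PEquiv.ofSet_eq_some_iff]
  grind

theorem pequiv_trans_symm_trans_self (f : α ≃. β) : (f.trans f.symm).trans f = f := by
  ext a b
  simp only [PEquiv.trans_eq_some (f.trans f.symm), pequiv_trans_symm_eq_some_iff]
  grind

theorem pequiv_trans_symm_comm (f : α ≃. β) (g : α ≃. γ) :
    (f.trans f.symm).trans (g.trans g.symm) = (g.trans g.symm).trans (f.trans f.symm) := by
  ext a b
  simp only [PEquiv.trans_eq_some (f.trans f.symm), PEquiv.trans_eq_some (g.trans g.symm),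
    pequiv_trans_symm_eq_some_iff]
  grind

end PartialBijections

namespace InvTerm

variable {C : Type u} [Category.{v} C] (Φ : C ⥤ Type w)
  (hΦ : ∀ ⦃x y : C⦄ (f : x ⟶ y), Function.Injective (Φ.map f))

/-- The action of formal expressions by partial bijections. -/
noncomputable def act : ∀ {X Y : C}, InvTerm C X Y → (Φ.obj X ≃. Φ.obj Y)
  | _, _, of f => pequivOfInjective (Φ.map f) (hΦ f)
  | _, _, comp s t => (act s).trans (act t)
  | _, _, inv t => (act t).symm

theorem act_of_id (X : C) : act Φ hΦ (of (𝟙 X)) = PEquiv.refl _ := by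
  ext
  simp [act]

theorem Rel.act_eq {X Y : C} {s t : InvTerm C X Y} (h : Rel s t) : act Φ hΦ s = act Φ hΦ t := by
  induction h with
  | refl => rfl
  | symm _ ih => exact ih.symm
  | trans _ _ ih ih' => exact ih.trans ih'
  | comp_congr _ _ ih ih' => simp only [act, ih, ih']
  | inv_congr _ ih => simp only [act, ih]
  | assoc => exact PEquiv.trans_assoc _ _ _
  | id_comp => rw [act, act_of_id, PEquiv.refl_trans]
  | comp_id => rw [act, act_of_id, PEquiv.trans_refl]
  | of_comp f g =>
    ext a b
    simp [act, PEquiv.trans_eq_some]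
  | inv_inv => rfl
  | regular => exact pequiv_trans_symm_trans_self _
  | comm => exact pequiv_trans_symm_comm _ _
  | monic f =>
    rw [act_of_id]
    ext a b
    simp [act, pequiv_trans_symm_eq_some_iff]

theorem exists_act_eq_of_zigzag {e e' : Φ.Elements} (h : Zigzag e e') :
    ∃ t : InvTerm C e.1 e'.1, act Φ hΦ t e.2 = some e'.2 := by
  induction h with
  | refl => exact ⟨of (𝟙 _), by simp [act_of_id]⟩
  | tail _ h ih =>
    obtain ⟨t, ht⟩ := ih
    rcases h with ⟨⟨f⟩⟩ | ⟨⟨f⟩⟩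
    · exact ⟨t.comp (of f.1), by simp [act, PEquiv.trans_eq_some, ht]⟩
    · refine ⟨t.comp (of f.1).inv, ?_⟩
      simp [act, PEquiv.trans_eq_some, ht, PEquiv.eq_some_iff]

end InvTerm

theorem IsUpwardSimplyConnected.hasTrivialMonodromy {C : Type u} [Category.{v} C]
    (h : IsUpwardSimplyConnected C) : HasTrivialMonodromy.{v, u, w} C := by
  intro Φ hΦ x a b hab
  obtain ⟨t, hta⟩ : ∃ t : InvTerm C x x, t.act Φ hΦ a = some b :=
    InvTerm.exists_act_eq_of_zigzag Φ hΦ hab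
  have htt : (t.comp t).act Φ hΦ = t.act Φ hΦ :=
    (_root_.Quotient.exact (h ⟨x⟩ (_root_.Quotient.mk _ t))).act_eq Φ hΦ
  have htb : t.act Φ hΦ b = some b := by
    simpa [InvTerm.act, PEquiv.trans_eq_some, hta] using DFunLike.congr_fun htt a
  exact (t.act Φ hΦ).inj hta htb

/-! ## Inverse categories -/

/-- A category with a pseudoinverse operation satisfying the equational axioms of inverse
categories. -/
class InverseCategory (C : Type u) [Category.{v} C] where
  /-- The pseudoinverse of a morphism. -/
  pinv {X Y : C} (f : X ⟶ Y) : Y ⟶ X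
  pinv_pinv {X Y : C} (f : X ⟶ Y) : pinv (pinv f) = f
  regular {X Y : C} (f : X ⟶ Y) : f ≫ pinv f ≫ f = f
  comm {X Y Z : C} (f : X ⟶ Y) (g : X ⟶ Z) :
    (f ≫ pinv f) ≫ g ≫ pinv g = (g ≫ pinv g) ≫ f ≫ pinv f

namespace InverseCategory

attribute [simp] pinv_pinv regular

variable {C : Type u} [Category.{v} C] [InverseCategory C] {X Y Z : C}

@[simp]
theorem regular_assoc (f : X ⟶ Y) (g : Y ⟶ Z) : f ≫ pinv f ≫ f ≫ g = f ≫ g := by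
  simpa only [Category.assoc] using congrArg (· ≫ g) (regular f)

@[simp]
theorem pinv_regular (f : X ⟶ Y) : pinv f ≫ f ≫ pinv f = pinv f := by
  simpa using regular (pinv f)

@[simp]
theorem pinv_regular_assoc (f : X ⟶ Y) (g : X ⟶ Z) :
    pinv f ≫ f ≫ pinv f ≫ g = pinv f ≫ g := by
  simpa using regular_assoc (pinv f) g

theorem pinv_eq_self_of_idem {e : X ⟶ X} (he : e ≫ e = e) : pinv e = e := by
  have he_assoc {W : C} (g : X ⟶ W) : e ≫ e ≫ g = e ≫ g := by
    rw [← Category.assoc, he]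
  have h_pinv : pinv e = (e ≫ pinv e) ≫ pinv e ≫ e :=
    calc pinv e = (pinv e ≫ e) ≫ e ≫ pinv e := by simp [he_assoc]
      _ = (e ≫ pinv e) ≫ pinv e ≫ e := by simpa using (comm e (pinv e)).symm
  calc pinv e = (e ≫ pinv e) ≫ pinv e ≫ e := h_pinv
    _ = e ≫ ((e ≫ pinv e) ≫ pinv e ≫ e) ≫ e := by simp [he, he_assoc]
    _ = e ≫ pinv e ≫ e := by rw [← h_pinv]
    _ = e := regular e

theorem idem_comm {e e' : X ⟶ X} (he : e ≫ e = e) (he' : e' ≫ e' = e') : e ≫ e' = e' ≫ e := by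
  simpa [pinv_eq_self_of_idem he, pinv_eq_self_of_idem he', he, he'] using comm e e'

theorem pinv_unique {f : X ⟶ Y} {g : Y ⟶ X} (hf : f ≫ g ≫ f = f) (hg : g ≫ f ≫ g = g) :
    g = pinv f := by
  have hl : (g ≫ f) ≫ pinv f ≫ f = (pinv f ≫ f) ≫ g ≫ f :=
    idem_comm (by simp [hf]) (by simp)
  have hr : (f ≫ g) ≫ f ≫ pinv f = (f ≫ pinv f) ≫ f ≫ g :=
    idem_comm (by simp [hg]) (by simp)
  have hgf : g ≫ f = pinv f ≫ f :=
    calc g ≫ f = (g ≫ f) ≫ pinv f ≫ f := by simp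
      _ = pinv f ≫ f ≫ g ≫ f := by rw [hl]; simp
      _ = pinv f ≫ f := by rw [hf]
  have hfg : f ≫ g = f ≫ pinv f :=
    calc f ≫ g = (f ≫ pinv f) ≫ f ≫ g := by simp
      _ = (f ≫ g ≫ f) ≫ pinv f := by rw [← hr]; simp
      _ = f ≫ pinv f := by rw [hf]
  calc g = g ≫ f ≫ g := hg.symm
    _ = (g ≫ f) ≫ pinv f := by rw [hfg]; simp
    _ = pinv f := by rw [hgf]; simp

@[simp]
theorem pinv_comp (f : X ⟶ Y) (g : Y ⟶ Z) : pinv (f ≫ g) = pinv g ≫ pinv f := by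
  have hc : (pinv f ≫ f) ≫ g ≫ pinv g = (g ≫ pinv g) ≫ pinv f ≫ f :=
    idem_comm (by simp) (by simp)
  refine (pinv_unique ?_ ?_).symm
  · calc (f ≫ g) ≫ (pinv g ≫ pinv f) ≫ f ≫ g
        = f ≫ ((g ≫ pinv g) ≫ pinv f ≫ f) ≫ g := by simp
      _ = f ≫ g := by rw [← hc]; simp
  · calc (pinv g ≫ pinv f) ≫ (f ≫ g) ≫ pinv g ≫ pinv f
        = pinv g ≫ ((pinv f ≫ f) ≫ g ≫ pinv g) ≫ pinv f := by simp
      _ = pinv g ≫ pinv f := by rw [hc]; simp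

end InverseCategory

namespace LeftFundamental

open InverseCategory

variable (C : Type u) [Category.{v} C]

instance : InverseCategory (LeftFundamental C) where
  pinv f := _root_.Quotient.map InvTerm.inv (fun _ _ h => InvTerm.Rel.inv_congr h) f
  pinv_pinv f := _root_.Quotient.inductionOn f fun t =>
    _root_.Quotient.sound (InvTerm.Rel.inv_inv t)
  regular f := _root_.Quotient.inductionOn f fun t =>
    _root_.Quotient.sound ((InvTerm.Rel.assoc _ _ _).symm.trans (InvTerm.Rel.regular t))
  comm f g := _root_.Quotient.inductionOn₂ f g fun s t =>
    _root_.Quotient.sound (InvTerm.Rel.comm s t)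

/-- The canonical functor from a category to its left fundamental inverse category. -/
def incl : C ⥤ LeftFundamental C where
  obj X := ⟨X⟩
  map f := _root_.Quotient.mk _ (InvTerm.of f)
  map_comp f g := _root_.Quotient.sound (InvTerm.Rel.of_comp f g)

variable {C}

theorem incl_map_comp_pinv {X Y : C} (f : X ⟶ Y) :
    (incl C).map f ≫ pinv ((incl C).map f) = 𝟙 _ :=
  _root_.Quotient.sound (InvTerm.Rel.monic f)

theorem hom_induction {P : ∀ {X Y : C}, ((incl C).obj X ⟶ (incl C).obj Y) → Prop}
    (map : ∀ {X Y : C} (f : X ⟶ Y), P ((incl C).map f))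
    (comp : ∀ {X Y Z : C} (g : (incl C).obj X ⟶ (incl C).obj Y)
      (h : (incl C).obj Y ⟶ (incl C).obj Z), P g → P h → P (g ≫ h))
    (pinv : ∀ {X Y : C} (g : (incl C).obj X ⟶ (incl C).obj Y), P g → P (pinv g))
    {X Y : C} (g : (incl C).obj X ⟶ (incl C).obj Y) : P g := by
  have of_term {X Y : C} (t : InvTerm C X Y) : P (X := X) (Y := Y) (_root_.Quotient.mk _ t) := by
    induction t with
    | of f => exact map f
    | comp _ _ ihs iht => exact comp _ _ ihs iht
    | inv _ ih => exact pinv _ ih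
  exact _root_.Quotient.inductionOn g of_term

/-- The functor of morphisms out of an object of the left fundamental inverse category. -/
def homsFrom (W : LeftFundamental C) : C ⥤ Type (max u v) := incl C ⋙ coyoneda.obj (.op W)

theorem homsFrom_map_injective (W : LeftFundamental C) ⦃X Y : C⦄ (f : X ⟶ Y) :
    Function.Injective ((homsFrom W).map f) := by
  have : IsSplitMono ((incl C).map f) := ⟨⟨_, incl_map_comp_pinv f⟩⟩
  exact fun g h hgh => (cancel_mono ((incl C).map f)).1 hgh

theorem zigzag_homsFrom {W : LeftFundamental C} {X Y : C} (g : (incl C).obj X ⟶ (incl C).obj Y)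
    (f : W ⟶ (incl C).obj X) (hf : f ≫ g ≫ pinv g = f) :
    Zigzag ((homsFrom W).elementsMk X f) ((homsFrom W).elementsMk Y (f ≫ g)) := by
  induction g using hom_induction with
  | map i => exact .of_hom ⟨i, rfl⟩
  | pinv g ih =>
    have hf : f ≫ pinv g ≫ g = f := by simpa using hf
    simpa [hf] using (ih (f ≫ pinv g) (by simp)).symm
  | comp g h ihg ihh =>
    have hg : f ≫ g ≫ pinv g = f := by
      rw [← hf]
      simp
    have hh : (f ≫ g) ≫ h ≫ pinv h = f ≫ g :=
      calc (f ≫ g) ≫ h ≫ pinv h = f ≫ g ≫ (pinv g ≫ g) ≫ h ≫ pinv h := by simp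
        _ = (f ≫ (g ≫ h) ≫ pinv (g ≫ h)) ≫ g := by
          rw [idem_comm (e := pinv g ≫ g) (by simp) (by simp)]
          simp
        _ = f ≫ g := by rw [hf]
    simpa using (ihg f hg).trans (ihh (f ≫ g) hh)

end LeftFundamental

open InverseCategory LeftFundamental in
theorem HasTrivialMonodromy.isUpwardSimplyConnected {C : Type u} [Category.{v} C]
    (h : HasTrivialMonodromy.{v, u, max u v} C) : IsUpwardSimplyConnected C := by
  suffices H : ∀ (x : C) (f : (incl C).obj x ⟶ (incl C).obj x), f ≫ f = f from
    fun X f => H X.as f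
  intro x f
  have hf : f ≫ pinv f = f :=
    calc f ≫ pinv f = (f ≫ pinv f) ≫ f :=
          h _ (homsFrom_map_injective _) x _ _ (zigzag_homsFrom f (f ≫ pinv f) (by simp))
      _ = f := by simp
  rw [← hf]
  simp

section UpperSet

open FreeGroupoid

variable {I : Type u} [Preorder I] {J : Set I}

/-- The functor sending `X` to the set of morphisms `x₀ ⟶ X` of the fundamental groupoid of the
upper set `J`, where this set is empty if `X` is not in `J`. -/
def homsInUpperSet (hJ : IsUpperSet J) (x₀ : J) : I ⥤ Type u where
  obj X := Σ' h : X ∈ J, (mk x₀ ⟶ mk ⟨X, h⟩)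
  map {X Y} f := ↾fun g => ⟨hJ (leOfHom f) g.1,
    g.2 ≫ homMk (homOfLE (leOfHom f) : (⟨X, g.1⟩ : J) ⟶ ⟨Y, hJ (leOfHom f) g.1⟩)⟩
  map_id _ := ConcreteCategory.hom_ext _ _ fun ⟨h, g⟩ => congrArg (PSigma.mk h) <|
    (congrArg (g ≫ ·) ((FreeGroupoid.of J).map_id _)).trans (Category.comp_id g)
  map_comp f f' := ConcreteCategory.hom_ext _ _ fun ⟨h, g⟩ =>
    congrArg (PSigma.mk (hJ (leOfHom (f ≫ f')) h)) <|
      (congrArg (g ≫ ·) ((FreeGroupoid.of J).map_comp _ _)).trans (Category.assoc _ _ _).symm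

theorem homsInUpperSet_map_injective (hJ : IsUpperSet J) (x₀ : J) ⦃X Y : I⦄ (f : X ⟶ Y) :
    Function.Injective ((homsInUpperSet hJ x₀).map f) := by
  rintro ⟨h, g⟩ ⟨h', g'⟩ hgg'
  exact congrArg (PSigma.mk h) ((cancel_mono _).1 (eq_of_heq (PSigma.mk.inj hgg').2))

theorem zigzag_homsInUpperSet (hJ : IsUpperSet J) {x₀ x : J} (g : mk x₀ ⟶ mk x) :
    Zigzag ((homsInUpperSet hJ x₀).elementsMk x₀ ⟨x₀.2, 𝟙 _⟩)
      ((homsInUpperSet hJ x₀).elementsMk x ⟨x.2, g⟩) := by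
  refine Localization.induction_structuredArrow (FreeGroupoid.of J) ⊤
    (fun g => Zigzag ((homsInUpperSet hJ x₀).elementsMk x₀ ⟨x₀.2, 𝟙 _⟩)
      ((homsInUpperSet hJ x₀).elementsMk g.right ⟨g.right.2, g.hom⟩)) (.refl _)
    (fun y z f g hg => hg.trans (.of_hom ⟨homOfLE (leOfHom f), rfl⟩))
    (fun y z f hf g hg => hg.trans (.of_inv ⟨homOfLE (leOfHom f), congrArg (PSigma.mk z.2) ?_⟩))
    (StructuredArrow.mk g)
  calc (g ≫ (Localization.isoOfHom (FreeGroupoid.of J) ⊤ f hf).inv) ≫ (FreeGroupoid.of J).map f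
    _ = g ≫ 𝟙 _ := by rw [Category.assoc, Localization.isoOfHom_inv_hom_id]
    _ = g := Category.comp_id g

theorem HasTrivialMonodromy.isSimplyConnectedCat (h : HasTrivialMonodromy.{u, u, u} I)
    (hJ : IsUpperSet J) : IsSimplyConnectedCat J := by
  have loop_eq_id (x : J) (g : mk x ⟶ mk x) : g = 𝟙 _ := by
    have := h _ (homsInUpperSet_map_injective hJ x) x _ _ (zigzag_homsInUpperSet hJ g)
    exact (eq_of_heq (PSigma.mk.inj this).2).symm
  refine fun x y => ⟨fun f g => ?_⟩
  have hfg : f ≫ Groupoid.inv g = 𝟙 x := loop_eq_id _ _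
  calc f = (f ≫ Groupoid.inv g) ≫ g := by simp
    _ = g := by rw [hfg, Category.id_comp]

end UpperSet

/-! ## Monodromy of tree-like posets -/

theorem HasTrivialMonodromy.of_unit {C : Type*} {D : Type*} [Category* C] [Category* D]
    {F : C ⥤ D} {G : D ⥤ C} (η : 𝟭 C ⟶ F ⋙ G) (h : HasTrivialMonodromy.{_, _, w} D) :
    HasTrivialMonodromy.{_, _, w} C := by
  intro Φ hΦ x a b hab
  let E : Φ.Elements ⥤ (G ⋙ Φ).Elements :=
    { obj e := ⟨F.obj e.1, Φ.map (η.app e.1) e.2⟩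
      map {e e'} f := ⟨F.map f.1,
        (NatTrans.naturality_apply (Functor.whiskerRight η Φ) f.1 e.2).symm.trans
          (congrArg (Φ.map (η.app e'.1)) f.2)⟩ }
  exact hΦ _ (h (G ⋙ Φ) (fun _ _ f => hΦ (G.map f)) _ _ _ (zigzag_obj_of_zigzag E hab))

theorem HasTrivialMonodromy.of_orderIso {P : Type*} {Q : Type*} [PartialOrder P] [PartialOrder Q]
    (e : P ≃o Q) (h : HasTrivialMonodromy.{_, _, w} Q) : HasTrivialMonodromy.{_, _, w} P :=
  h.of_unit e.equivalence.unit

/-- The category structure is given explicitly because a sigma type also carries that of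
`CategoryTheory.Sigma.sigma`. -/
theorem HasTrivialMonodromy.sigma {ι : Type*} {P : ι → Type*} [∀ i, Preorder (P i)]
    (h : ∀ i, HasTrivialMonodromy.{_, _, w} (P i)) :
    @HasTrivialMonodromy.{_, _, w} (Σ i, P i) (Preorder.smallCategory _) := by
  let : Category (Σ i, P i) := Preorder.smallCategory _
  intro Φ hΦ ⟨i, x⟩ a b hab
  have mk_monotone (i : ι) : Monotone (Sigma.mk i : P i → Σ i, P i) :=
    fun _ _ hxy => Sigma.mk_le_mk_iff.2 hxy
  let Ψ (i : ι) : P i ⥤ Type w := (mk_monotone i).functor ⋙ Φ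
  let label : Φ.Elements → Σ i, ConnectedComponents (Ψ i).Elements
    | ⟨⟨i, x⟩, a⟩ => ⟨i, .mk ⟨x, a⟩⟩
  have label_eq ⦃e e' : Φ.Elements⦄ (f : e ⟶ e') : label e = label e' := by
    obtain ⟨⟨i, x⟩, a⟩ := e
    obtain ⟨⟨j, y⟩, b⟩ := e'
    obtain ⟨f, hf⟩ := f
    obtain ⟨_, _, _, hxy⟩ := leOfHom f
    exact congrArg (Sigma.mk i) (_root_.Quotient.sound (.of_hom ⟨homOfLE hxy, hf⟩))
  have hlabel := eq_of_heq (Sigma.mk.inj (apply_eq_of_zigzag label_eq hab)).2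
  exact h i (Ψ i) (fun _ _ f => hΦ _) x a b (_root_.Quotient.exact hlabel)

namespace AdjoinBelow

variable {P : Type u} [PartialOrder P] {U : UpperSet P}

/-- The inclusion of `P` in the poset obtained by adjoining a point. -/
def incl (P : Type u) [PartialOrder P] (U : UpperSet P) : P ⥤ AdjoinBelow P U :=
  Monotone.functor (f := of) fun _ _ h => h

/-- The arrow from the adjoined point to an element of `U`. -/
def ptHom (x : U) : (pt : AdjoinBelow P U) ⟶ of x.1 := homOfLE x.2

variable (Φ : AdjoinBelow P U ⥤ Type w)

/-- The transport of an element over the adjoined point to all points of `U`. -/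
def branch (c : Φ.obj pt) : U ⥤ (incl P U ⋙ Φ).Elements where
  obj x := ⟨x.1, Φ.map (ptHom x) c⟩
  map {x y} f := ⟨homOfLE (leOfHom f), (Functor.map_comp_apply Φ (ptHom x) _ c).symm⟩

/-- The connected component, among all elements of `Φ`, of an element `c` over the adjoined point:
it consists of `c` and of the components of its transports in the elements over `P`. -/
def Star (c : Φ.obj pt) : Φ.Elements → Prop
  | ⟨pt, c'⟩ => c' = c
  | ⟨of x, a⟩ => ∃ y : U, Zigzag ((branch Φ c).obj y) ((incl P U ⋙ Φ).elementsMk x a)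

variable {Φ}

theorem elements_hom_cases {R : Φ.Elements → Φ.Elements → Prop}
    (pt_pt : ∀ c, R ⟨pt, c⟩ ⟨pt, c⟩)
    (pt_of : ∀ (c : Φ.obj pt) (y : U), R ⟨pt, c⟩ ⟨of y, Φ.map (ptHom y) c⟩)
    (of_of : ∀ {d d' : (incl P U ⋙ Φ).Elements}, (d ⟶ d') → R ⟨of d.1, d.2⟩ ⟨of d'.1, d'.2⟩)
    {e e' : Φ.Elements} (f : e ⟶ e') : R e e' := by
  obtain ⟨z, a⟩ := e
  obtain ⟨z', b⟩ := e'
  obtain ⟨(f : z ⟶ z'), hf⟩ := f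
  obtain rfl : Φ.map f a = b := hf
  rcases z with _ | x <;> rcases z' with _ | y
  · rw [Subsingleton.elim f (𝟙 _), Functor.map_id_apply]
    exact pt_pt a
  · exact pt_of a ⟨y, leOfHom f⟩
  · exact (leOfHom f).elim
  · let f' : x ⟶ y := homOfLE (leOfHom f)
    exact of_of (d := ⟨x, a⟩) (d' := ⟨y, Φ.map f a⟩) ⟨f', rfl⟩

variable (hΦ : ∀ ⦃x y⦄ (f : x ⟶ y), Function.Injective (Φ.map f))
  (hP : HasTrivialMonodromy.{u, u, w} P)
  (hU : ∀ x y : U, Zigzag (x : P) (y : P) → Zigzag x y)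

include hU in
theorem zigzag_branch {c c' : Φ.obj pt} {x y : U}
    (h : Zigzag ((branch Φ c).obj x) ((branch Φ c').obj y)) :
    Zigzag ((branch Φ c).obj x) ((branch Φ c).obj y) :=
  zigzag_obj_of_zigzag (branch Φ c)
    (hU x y (zigzag_obj_of_zigzag (CategoryOfElements.π (incl P U ⋙ Φ)) h))

include hΦ hP hU

theorem eq_of_zigzag_branch {c c' : Φ.obj pt} {x y : U}
    (h : Zigzag ((branch Φ c).obj x) ((branch Φ c').obj y)) : c = c' :=
  hΦ (ptHom y) (hP (incl P U ⋙ Φ) (fun _ _ _ => hΦ _) y.1 _ _ ((zigzag_branch hU h).symm.trans h))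

theorem star_iff_of_hom (c : Φ.obj pt) {e e' : Φ.Elements} (f : e ⟶ e') :
    Star Φ c e ↔ Star Φ c e' := by
  refine elements_hom_cases (R := fun e e' => Star Φ c e ↔ Star Φ c e') (fun _ => .rfl) ?_ ?_ f
  · refine fun c' y => ⟨?_, fun ⟨_, hx⟩ => (eq_of_zigzag_branch hΦ hP hU hx).symm⟩
    rintro rfl
    exact ⟨y, .refl _⟩
  · intro d d' f
    exact ⟨fun ⟨x, hx⟩ => ⟨x, hx.trans (.of_hom f)⟩, fun ⟨x, hx⟩ => ⟨x, hx.trans (.of_inv f)⟩⟩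

theorem Star.eq {c : Φ.obj pt} {z : AdjoinBelow P U} {a b : Φ.obj z} (ha : Star Φ c ⟨z, a⟩)
    (hb : Star Φ c ⟨z, b⟩) : a = b := by
  cases z with
  | pt => exact Eq.trans ha (Eq.symm hb)
  | of x =>
    obtain ⟨y, hy⟩ := ha
    obtain ⟨y', hy'⟩ := hb
    have hyy' : Zigzag y y' :=
      hU y y' ((zigzag_obj_of_zigzag (CategoryOfElements.π _) hy).trans
        (zigzag_obj_of_zigzag (CategoryOfElements.π _) hy').symm)
    exact hP (incl P U ⋙ Φ) (fun _ _ _ => hΦ _) x a b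
      (hy.symm.trans ((zigzag_obj_of_zigzag (branch Φ c) hyy').trans hy'))

omit hΦ in
theorem hasTrivialMonodromy : HasTrivialMonodromy.{u, u, w} (AdjoinBelow P U) := by
  intro Φ hΦ z a b hab
  by_cases h : ∃ c, Star Φ c ⟨z, a⟩
  · obtain ⟨c, ha⟩ := h
    have hb : Star Φ c ⟨z, b⟩ := by
      rwa [← apply_eq_of_zigzag (fun _ _ f => propext (star_iff_of_hom hΦ hP hU c f)) hab]
    exact ha.eq hΦ hP hU hb
  · cases z with
    | pt => exact (h ⟨a, rfl⟩).elim
    | of x =>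
      let SameComponent : Φ.Elements → Prop
        | ⟨pt, _⟩ => False
        | ⟨of y, d⟩ => Zigzag ((incl P U ⋙ Φ).elementsMk x a) ⟨y, d⟩
      have invariant ⦃e e' : Φ.Elements⦄ (f : e ⟶ e') : SameComponent e = SameComponent e' := by
        refine elements_hom_cases (R := fun e e' => SameComponent e = SameComponent e')
          (fun _ => rfl) ?_ ?_ f
        · exact fun c y => (eq_false fun hy => h ⟨c, y, hy.symm⟩).symm
        · exact fun f => propext ⟨fun h => h.trans (.of_hom f), fun h => h.trans (.of_inv f)⟩
      have hab : SameComponent ⟨of x, b⟩ :=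
        (apply_eq_of_zigzag invariant hab).mp (Zigzag.refl ((incl P U ⋙ Φ).elementsMk x a))
      exact hP (incl P U ⋙ Φ) (fun _ _ _ => hΦ _) x a b hab

end AdjoinBelow

theorem zigzag_sigmaUpperSet {n : ℕ} {K : Fin n → Type u} [∀ k, PartialOrder (K k)]
    {U : ∀ k, UpperSet (K k)} (hU : ∀ k, IsPreconnected (U k)) (x y : sigmaUpperSet U)
    (h : @Zigzag (Σ k, K k) (Preorder.smallCategory _) x y) : Zigzag x y := by
  let : Category (Σ k, K k) := Preorder.smallCategory _
  have fst_eq ⦃z z' : Σ k, K k⦄ (f : z ⟶ z') : z.1 = z'.1 := by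
    obtain ⟨_, _, _, _⟩ := leOfHom f
    rfl
  obtain ⟨⟨k, x⟩, hx⟩ := x
  obtain ⟨⟨l, y⟩, hy⟩ := y
  obtain rfl : k = l := apply_eq_of_zigzag fst_eq h
  let mk : U k → sigmaUpperSet U := fun z => ⟨⟨k, z⟩, z.2⟩
  have mk_monotone : Monotone mk := fun _ _ hz => Sigma.mk_le_mk_iff.2 hz
  exact zigzag_obj_of_zigzag mk_monotone.functor
    (isPreconnected_zigzag (J := U k) ⟨x, hx⟩ ⟨y, hy⟩)

theorem IsTreeLike.hasTrivialMonodromy {P : Type u} [PartialOrder P] (h : IsTreeLike P) :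
    HasTrivialMonodromy.{u, u, w} P := by
  induction h with
  | adjoin K U _ conn P e hK =>
    exact .of_orderIso e (AdjoinBelow.hasTrivialMonodromy (.sigma hK)
      (zigzag_sigmaUpperSet fun k => (conn k).toIsPreconnected))

theorem IsForestLike.hasTrivialMonodromy {P : Type u} [PartialOrder P] (h : IsForestLike P) :
    HasTrivialMonodromy.{u, u, w} P := by
  obtain ⟨n, K, _, hK, ⟨e⟩⟩ := h
  exact .of_orderIso e (.sigma fun k => (hK k).hasTrivialMonodromy)

/-! ## Removing a minimal element -/

section RemoveMinimal

open FreeGroupoid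

variable {P : Type*} [PartialOrder P] {p : P} {Γ : Type*} [Group Γ]

open Classical in
/-- The functor from a poset to a group with value `g x` at the arrow from the minimal element `p`
to `x`, and trivial on the arrows between the other elements. -/
noncomputable def spokeFunctor (hp : IsMin p) {g : P → Γ} (hgp : g p = 1)
    (hg : ∀ y z, p < y → y ≤ z → g y = g z) : P ⥤ SingleObj Γ where
  obj _ := SingleObj.star Γ
  map {x y} _ := (if x = p then g y else 1 : Γ)
  map_id x := by
    split_ifs with hx
    · exact hx ▸ hgp
    · rfl
  map_comp {x y z} f f' := by
    change _ = (if y = p then g z else 1) * (if x = p then g y else 1)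
    by_cases hx : x = p
    · subst hx
      rcases (leOfHom f).eq_or_lt with rfl | hxy
      · simp only [if_true, hgp, mul_one]
      · simp only [if_true, if_neg hxy.ne', one_mul, hg y z hxy (leOfHom f')]
    · have hy : y ≠ p := fun hy => hx (hp.eq_of_le ((leOfHom f).trans hy.le))
      simp only [if_neg hx, if_neg hy, one_mul]

/-- A zeroth cohomology class of the elements above a minimal element `p` extends to all elements
other than `p`, since the obstruction is a first cohomology class of a simply-connected poset. -/
theorem IsSimplyConnectedCat.exists_extension [IsPreconnected P] (h : IsSimplyConnectedCat P)
    (hp : IsMin p) {g : P → Γ} (hgp : g p = 1) (hg : ∀ y z, p < y → y ≤ z → g y = g z) :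
    ∃ c : P → Γ, (∀ y z, y ≠ p → y ≤ z → c y = c z) ∧ ∀ y, p ≤ y → c y = g y := by
  let Φ := lift (spokeFunctor hp hgp hg)
  have : IsPreconnected (FreeGroupoid P) := zigzag_isPreconnected fun x y =>
    zigzag_obj_of_zigzag (FreeGroupoid.of P) (isPreconnected_zigzag (J := P) x.as.as y.as.as)
  let path (x : P) : mk p ⟶ mk x := (nonempty_hom_of_preconnected_groupoid _ _).some
  let c (x : P) : Γ := Φ.map (path x)
  have c_eq {x y : P} (hxy : x ≤ y) :
      c y = ((spokeFunctor hp hgp hg).map (homOfLE hxy) : Γ) * c x := by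
    have path_eq : path y = path x ≫ homMk (homOfLE hxy) := (h _ _).elim _ _
    simp only [c, path_eq, Functor.map_comp, Φ, lift_map_homMk]
    rfl
  have c_p : c p = 1 :=
    (congrArg Φ.map ((h _ _).elim (path p) (𝟙 _))).trans (Φ.map_id _)
  refine ⟨c, fun y z hy hyz => ?_, fun y hy => ?_⟩
  · rw [c_eq hyz, spokeFunctor]
    simp only [if_neg hy, one_mul]
  · rw [c_eq hy, spokeFunctor, c_p]
    simp only [if_true, mul_one]

end RemoveMinimal

theorem isUpperSet_sdiff_minimal {P : Type*} [PartialOrder P] {A : Set P} {p : P}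
    (hA : IsUpperSet A) (hp : Minimal (· ∈ A) p) : IsUpperSet (A \ {p}) :=
  hA.sdiff fun _ hb _ hc hbc => hp.eq_of_le hb (hc ▸ hbc)

/-- The set `B` is the disjoint union of the sets `S i`, and elements of different `S i` are
incomparable. -/
structure IsDisjointSum {P : Type*} [Preorder P] {ι : Type*} (B : Set P) (S : ι → Set P) :
    Prop where
  iUnion_eq : ⋃ i, S i = B
  eq_of_le : ∀ ⦃i j x y⦄, x ∈ S i → y ∈ S j → x ≤ y → i = j

namespace IsDisjointSum

section Preorder

variable {P : Type*} [Preorder P] {ι : Type*} {B : Set P} {S : ι → Set P}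

theorem subset (h : IsDisjointSum B S) (i : ι) : S i ⊆ B :=
  h.iUnion_eq ▸ Set.subset_iUnion S i

theorem exists_mem (h : IsDisjointSum B S) {x : P} (hx : x ∈ B) : ∃ i, x ∈ S i :=
  Set.mem_iUnion.1 (h.iUnion_eq ▸ hx)

theorem mem_iff_mem (h : IsDisjointSum B S) (hB : IsUpperSet B) {x y : P} (hx : x ∈ B)
    (hxy : x ≤ y) (i : ι) : x ∈ S i ↔ y ∈ S i := by
  obtain ⟨j, hj⟩ := h.exists_mem hx
  obtain ⟨k, hk⟩ := h.exists_mem (hB hxy hx)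
  obtain rfl := h.eq_of_le hj hk hxy
  exact ⟨fun hi => h.eq_of_le hi hj le_rfl ▸ hk, fun hi => h.eq_of_le hi hk le_rfl ▸ hj⟩

theorem isUpperSet (h : IsDisjointSum B S) (hB : IsUpperSet B) (i : ι) : IsUpperSet (S i) :=
  fun _ _ hxy hx => (h.mem_iff_mem hB (h.subset i hx) hxy i).1 hx

theorem exists_isConnected (B : Set P) [Finite B] :
    ∃ (n : ℕ) (S : Fin n → Set P), IsDisjointSum B S ∧ ∀ k, IsConnected (S k) := by
  have : Finite (ConnectedComponents B) := Quotient.finite _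
  obtain ⟨n, ⟨g⟩⟩ := Finite.exists_equiv_fin (ConnectedComponents B)
  let S (k : Fin n) : Set P := {x | ∃ hx : x ∈ B, g (.mk ⟨x, hx⟩) = k}
  refine ⟨n, S, ⟨?_, ?_⟩, fun k => ?_⟩
  · ext x
    exact Set.mem_iUnion.trans ⟨fun ⟨_, hx, _⟩ => hx, fun hx => ⟨_, hx, rfl⟩⟩
  · rintro _ _ x y ⟨hx, rfl⟩ ⟨hy, rfl⟩ hxy
    exact congrArg g (_root_.Quotient.sound (.of_hom (homOfLE hxy)))
  · let toPiece (x : (g.symm k).Component) : S k :=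
      ⟨x.obj, x.obj.2, (congrArg g x.property).trans (g.apply_symm_apply k)⟩
    let F : (g.symm k).Component ⥤ S k :=
      { obj := toPiece
        map f := homOfLE (leOfHom f.hom) }
    have : Nonempty (S k) := .map toPiece inferInstance
    refine zigzag_isConnected ?_
    rintro ⟨x, hx, hxk⟩ ⟨y, hy, hyk⟩
    exact zigzag_obj_of_zigzag F (isPreconnected_zigzag
      (J := (g.symm k).Component) ⟨⟨x, hx⟩, g.eq_symm_apply.2 hxk⟩ ⟨⟨y, hy⟩, g.eq_symm_apply.2 hyk⟩)

end Preorder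

section PartialOrder

variable {P : Type u} [PartialOrder P]

/-- A set which is a disjoint sum is isomorphic to the disjoint union of the summands. -/
noncomputable def orderIso {ι : Type*} {B : Set P} {S : ι → Set P} (h : IsDisjointSum B S) :
    (Σ i, S i) ≃o B :=
  RelIso.ofSurjective
    (OrderEmbedding.ofMapLEIff (fun s => ⟨s.2, h.subset _ s.2.2⟩) (by
      rintro ⟨i, x⟩ ⟨j, y⟩
      refine ⟨fun hxy => ?_, fun ⟨_, _, _, hxy⟩ => hxy⟩
      obtain rfl := h.eq_of_le x.2 y.2 hxy
      exact Sigma.mk_le_mk_iff.2 hxy))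
    fun ⟨x, hx⟩ => (h.exists_mem hx).elim fun i hi => ⟨⟨i, x, hi⟩, rfl⟩

variable {n : ℕ} {S : Fin n → Set P}

theorem isTreeLike {A : Set P} {p : P} (hp : Minimal (· ∈ A) p) (h : IsDisjointSum (A \ {p}) S)
    (tree : ∀ k, IsTreeLike (S k)) (conn : ∀ k, IsConnected {x : S k // p ≤ x}) :
    IsTreeLike A := by
  let U (k : Fin n) : UpperSet (S k) := ⟨{x | p ≤ x}, fun _ _ hxy hx => hx.trans hxy⟩
  let f : AdjoinBelow (Σ k, S k) (sigmaUpperSet U) → A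
    | .pt => ⟨p, hp.prop⟩
    | .of s => ⟨h.orderIso s, (h.orderIso s).2.1⟩
  have f_le_f {a b} : f a ≤ f b ↔ a ≤ b := by
    rcases a with _ | s <;> rcases b with _ | t
    · exact iff_of_true le_rfl le_rfl
    · exact Iff.rfl
    · exact iff_of_false
        (fun hs => (h.orderIso s).2.2 (hp.eq_of_le (h.orderIso s).2.1 hs)) id
    · exact h.orderIso.le_iff_le
  have f_surjective : Function.Surjective f := by
    rintro ⟨x, hx⟩
    by_cases hxp : x = p
    · exact ⟨.pt, Subtype.ext hxp.symm⟩
    · obtain ⟨s, hs⟩ := h.orderIso.surjective ⟨x, hx, hxp⟩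
      exact ⟨.of s, Subtype.ext (show (h.orderIso s : P) = x by rw [hs])⟩
  exact .adjoin (fun k => S k) U tree conn A
    (RelIso.ofSurjective (OrderEmbedding.ofMapLEIff f fun _ _ => f_le_f) f_surjective).symm

end PartialOrder

section Remove

variable {P : Type*} [PartialOrder P] {ι : Type*} {A : Set P} {p : P} {S : ι → Set P}

theorem exists_mem_le (h : IsDisjointSum (A \ {p}) S) (hA : IsUpperSet A)
    (hp : Minimal (· ∈ A) p) [IsPreconnected A] {i : ι} (hi : (S i).Nonempty) :
    ∃ x ∈ S i, p ≤ x := by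
  by_contra! not_le
  have mem_iff ⦃x y : A⦄ (hxy : x ⟶ y) : x.1 ∈ S i ↔ y.1 ∈ S i := by
    by_cases hxp : x.1 = p
    · exact iff_of_false (fun hx => not_le x hx hxp.ge)
        fun hy => not_le y hy (hxp.symm.trans_le (leOfHom hxy))
    · exact h.mem_iff_mem (isUpperSet_sdiff_minimal hA hp) ⟨x.2, hxp⟩ (leOfHom hxy) i
  obtain ⟨x, hx⟩ := hi
  have hpx : p ∈ S i ↔ x ∈ S i := Iff.of_eq <| apply_eq_of_zigzag
    (fun _ _ f => propext (mem_iff f))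
    (isPreconnected_zigzag (J := A) ⟨p, hp.prop⟩ ⟨x, (h.subset i hx).1⟩)
  exact not_le p (hpx.2 hx) le_rfl

/-- A function that is locally constant on the part of `S i` above `p`, with values in a free
group, extends to `A \ {p}` and so is constant because `S i` is connected. -/
theorem isConnected_above (h : IsDisjointSum (A \ {p}) S) (hA : IsUpperSet A)
    (hp : Minimal (· ∈ A) p) [IsPreconnected A] (hA' : IsSimplyConnectedCat A) (i : ι)
    [IsConnected (S i)] : IsConnected {x : S i // p ≤ x} := by
  have S_nonempty : (S i).Nonempty := Set.nonempty_coe_sort.1 IsConnected.is_nonempty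
  obtain ⟨x, hx, hpx⟩ := h.exists_mem_le hA hp S_nonempty
  have : Nonempty {x : S i // p ≤ x} := ⟨⟨⟨x, hx⟩, hpx⟩⟩
  refine .of_constant_of_preserves_morphisms fun {α} F hF a b => ?_
  classical
  let g (y : A) : FreeGroup α :=
    if hy : y.1 ∈ S i ∧ p ≤ y.1 then .of (F ⟨⟨y, hy.1⟩, hy.2⟩) else 1
  have p_notMem : p ∉ S i := fun hpi => (h.subset i hpi).2 rfl
  have hg (y z : A) (hpy : ⟨p, hp.prop⟩ < y) (hyz : y ≤ z) : g y = g z := by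
    have hpz := hpy.le.trans hyz
    have hyz' := h.mem_iff_mem (isUpperSet_sdiff_minimal hA hp)
      ⟨y.2, fun hyp => hpy.ne' (Subtype.ext hyp)⟩ hyz i
    by_cases hy : y.1 ∈ S i
    · rw [show g y = _ from dif_pos ⟨hy, hpy.le⟩, show g z = _ from dif_pos ⟨hyz'.1 hy, hpz⟩]
      exact congrArg FreeGroup.of (hF (homOfLE hyz))
    · rw [show g y = 1 from dif_neg fun h => hy h.1,
        show g z = 1 from dif_neg fun h => hy (hyz'.2 h.1)]
  obtain ⟨c, c_const, c_above⟩ := hA'.exists_extension (fun y hy => (hp.le_of_le y.2 hy : p ≤ y))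
    (dif_neg fun h => p_notMem h.1) hg
  let toA (y : S i) : A := ⟨y, (h.subset i y.2).1⟩
  have c_toA_eq : c (toA a.1) = c (toA b.1) :=
    constant_of_preserves_morphisms (fun y : S i => c (toA y)) (fun y z f =>
      c_const _ _ (fun hyp => (h.subset i y.2).2 (congrArg Subtype.val hyp)) (leOfHom f)) _ _
  have c_eq (y : {x : S i // p ≤ x}) : c (toA y.1) = .of (F y) :=
    (c_above _ y.2).trans (dif_pos ⟨y.1.2, y.2⟩)
  exact FreeGroup.of_injective (by rw [← c_eq a, ← c_eq b, c_toA_eq])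

end Remove

end IsDisjointSum

section SimplyConnected

variable {I : Type u} [PartialOrder I] [Finite I]
  (h : ∀ J : Set I, IsUpperSet J → IsSimplyConnectedCat J)

include h

theorem isTreeLike_of_isSimplyConnectedCat (A : Set I) (hA : IsUpperSet A) (conn : IsConnected A) :
    IsTreeLike A := by
  induction A using WellFoundedLT.induction with
  | ind A ih =>
    obtain ⟨p, hp⟩ := A.toFinite.exists_minimal (Set.nonempty_coe_sort.1 conn.is_nonempty)
    obtain ⟨n, S, hS, hSconn⟩ := IsDisjointSum.exists_isConnected (A \ {p})
    refine hS.isTreeLike hp (fun k => ?_) fun k => hS.isConnected_above hA hp (h A hA) k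
    have ssubset : S k ⊂ A := (hS.subset k).trans_ssubset (Set.sdiff_singleton_ssubset.2 hp.prop)
    exact ih (S k) ssubset (hS.isUpperSet (isUpperSet_sdiff_minimal hA hp) k) (hSconn k)

theorem isForestLike_of_isSimplyConnectedCat : IsForestLike I := by
  obtain ⟨n, S, hS, hSconn⟩ := IsDisjointSum.exists_isConnected (Set.univ : Set I)
  refine ⟨n, fun k => S k, inferInstance, fun k => ?_,
    ⟨(hS.orderIso.trans OrderIso.Set.univ).symm⟩⟩
  exact isTreeLike_of_isSimplyConnectedCat h _ (hS.isUpperSet isUpperSet_univ k) (hSconn k)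

end SimplyConnected

theorem corollary4p7 (I : Type u) [PartialOrder I] [Finite I] :
    (IsUpwardSimplyConnected I ↔ ∀ J : Set I, IsUpperSet J → IsSimplyConnectedCat J) ∧
    ((∀ J : Set I, IsUpperSet J → IsSimplyConnectedCat J) ↔ IsForestLike I) := by
  have simplyConnected_of_upward (h : IsUpwardSimplyConnected I) (J : Set I) (hJ : IsUpperSet J) :
      IsSimplyConnectedCat J :=
    h.hasTrivialMonodromy.isSimplyConnectedCat hJ
  have upward_of_forestLike (h : IsForestLike I) : IsUpwardSimplyConnected I :=
    h.hasTrivialMonodromy.isUpwardSimplyConnected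
  exact ⟨⟨simplyConnected_of_upward,
      fun h => upward_of_forestLike (isForestLike_of_isSimplyConnectedCat h)⟩,
    ⟨isForestLike_of_isSimplyConnectedCat,
      fun h => simplyConnected_of_upward (upward_of_forestLike h)⟩⟩
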